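/- Let $x_0\in\mathbf R^n$ with $\|x_0\|=1$, let $A\in\mathbf R^{N\times n}$ be a random matrix with i.i.d. standard normal $N(0,1)$ entries and rows $a_1,\dots,a_N$, and let $b_i=|a_i\cdot x_0|$ for $i=1,\dots,N$. For $1\le N_I\le N$ let $I\subset\{1,\dots,N\}$ be the set of indices of the $N_I$ smallest numbers among $b_1,\dots,b_N$ (ties broken by the index), and let $b_I=(b_i)_{i\in I}$, so that $\|b_I\|^2=\sum_{i\in I}b_i^2$. For every constant $c>0$ there is a constant $c_6>0$, depending only on $c$, such that the following holds. For every $\rho_0>0$ and every $\alpha\ge 1$ there is a constant $c_\alpha>0$, depending only on $\alpha$, $\rho_0$ and $c$, such that for all $n$, $N$, $N_I$, $x_0$ and $A$ as above with $\rho_0\le N_I/N<c$, \[ \mathbb P\Big( N_I^{-1/2}\,\|b_I\|\le c_6\,(\pi/6)^{1/2}\,\frac{N_I}{N}\Big)\ \ge\ 1-c_\alpha N^{-\alpha}. \] In particular, $c_6$ does not depend on $n$, $N$, $N_I$, $\rho_0$ or $\alpha$. -/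

import Mathlib

open MeasureTheory ProbabilityTheory

/-- The magnitude measurements `b i = |a_i · x₀|`, where `a_i` is the `i`-th row of `A`. -/
noncomputable def magnitudes {N n : ℕ} (A : Matrix (Fin N) (Fin n) ℝ)
    (x₀ : EuclideanSpace ℝ (Fin n)) : Fin N → ℝ :=
  fun i => |∑ j, A i j * x₀ j|

/-- The indices of the `k` smallest entries of `b`: after sorting the entries increasingly
(ties broken by the index), the first `k` of them. -/
noncomputable def smallestIndices {N : ℕ} (b : Fin N → ℝ) (k : ℕ) : Finset (Fin N) :=
  (Finset.univ.filter fun i : Fin N => (i : ℕ) < k).map (Tuple.sort b).toEmbedding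

theorem card_smallestIndices {N : ℕ} (b : Fin N → ℝ) {k : ℕ} (hk : k ≤ N) :
    (smallestIndices b k).card = k := by
  simp [smallestIndices, Fin.card_filter_val_lt, hk]

theorem le_of_mem_smallestIndices {N : ℕ} (b : Fin N → ℝ) {k : ℕ} {i j : Fin N}
    (hi : i ∈ smallestIndices b k) (hj : j ∉ smallestIndices b k) : b i ≤ b j := by
  simp only [smallestIndices, Finset.mem_map_equiv, Finset.mem_filter, Finset.mem_univ,
    true_and, not_lt] at hi hj
  have h := Tuple.monotone_sort b
    (show (Tuple.sort b).symm i ≤ (Tuple.sort b).symm j from (hi.trans_le hj).le)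
  simpa using h

/-- The vector `b_I` made of the entries of `b` with index in `I`, as a Euclidean vector. -/
noncomputable def subvector {N : ℕ} (b : Fin N → ℝ) (I : Finset (Fin N)) :
    EuclideanSpace ℝ I :=
  WithLp.toLp 2 fun i => b i

theorem norm_sq_subvector {N : ℕ} (b : Fin N → ℝ) (I : Finset (Fin N)) :
    ‖subvector b I‖ ^ 2 = ∑ i ∈ I, b i ^ 2 := by
  simpa [subvector, EuclideanSpace.norm_sq_eq] using Finset.sum_attach I fun i => b i ^ 2

/-- `A` is a random `N × n` matrix with independent standard normal entries. -/
structure IsStdGaussianMatrix {Ω : Type*} [MeasurableSpace Ω] (P : Measure Ω) {N n : ℕ}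
    (A : Ω → Matrix (Fin N) (Fin n) ℝ) : Prop where
  hasLaw : ∀ i j, HasLaw (fun ω => A ω i j) (gaussianReal 0 1) P
  indep : iIndepFun (fun (p : Fin N × Fin n) ω => A ω p.1 p.2) P

/-! Since `‖x₀‖ = 1`, the products `a_i · x₀` are i.i.d. standard normal. Put `ρ = N_I / N`. If `ρ ≤
1/16`, the interval `[-16ρ, 16ρ]` has Gaussian mass at least `2ρ`, so by Hoeffding
(`measureReal_card_abs_le_lt`) at least `N_I` of the products fall in it, up to probability `exp
(-2ρ²N)`; the `N_I` smallest magnitudes are then at most `16ρ`. If `ρ > 1/16`, bounding `‖b_I‖²` by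
the full chi-square sum suffices (`measureReal_four_mul_le_sum_sq`). Both failure probabilities are
exponentially small in `N`, at a rate set by `ρ₀`. -/

section Gaussian

variable {Ω : Type*} [MeasurableSpace Ω] {P : Measure Ω}

/-- The rows of a family of independent random variables indexed by a finite product
are independent. -/
theorem iIndepFun_rows {ι κ : Type*} [Fintype ι] [Fintype κ] [IsProbabilityMeasure P]
    {X : ι × κ → Ω → ℝ} (hm : ∀ p, AEMeasurable (X p) P) (h : iIndepFun X P) :
    iIndepFun (fun i ω j => X (i, j) ω) P := by
  have hrow (i : ι) : AEMeasurable (fun ω j => X (i, j) ω) P :=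
    aemeasurable_pi_iff.2 fun j => hm (i, j)
  have hp (p : ι × κ) : IsProbabilityMeasure (P.map (X p)) := Measure.isProbabilityMeasure_map (hm p)
  rw [iIndepFun_iff_map_fun_eq_infinitePi_map₀' hrow]
  have h1 := h.map_fun_eq_infinitePi_map₀' hm
  have h2 (i : ι) : P.map (fun ω j => X (i, j) ω) =
      Measure.infinitePi fun j => P.map (X (i, j)) :=
    (h.precomp (Prod.mk_right_injective i)).map_fun_eq_infinitePi_map₀' fun j => hm (i, j)
  simp_rw [h2]
  -- Currying turns the product law over pairs into a product of row laws.
  rw [← Measure.infinitePi_map_curry (fun i j => P.map (X (i, j))), ← h1,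
    AEMeasurable.map_map_of_aemeasurable (by fun_prop) (aemeasurable_pi_iff.2 hm)]
  rfl

/-- A linear combination, with coefficient vector of norm one, of independent standard normal
variables is standard normal. -/
theorem hasLaw_sum_mul_gaussianReal {κ : Type*} [Fintype κ] [IsProbabilityMeasure P]
    {X : κ → Ω → ℝ} (hX : ∀ j, HasLaw (X j) (gaussianReal 0 1) P) (h : iIndepFun X P)
    {w : κ → ℝ} (hw : ∑ j, w j ^ 2 = 1) :
    HasLaw (fun ω => ∑ j, X j ω * w j) (gaussianReal 0 1) P := by
  have hm (j : κ) : AEMeasurable (fun ω => X j ω * w j) P := (hX j).aemeasurable.mul_const _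
  refine ⟨Finset.aemeasurable_fun_sum _ fun j _ => hm j, ?_⟩
  refine Measure.ext_of_charFun ?_
  have hind : iIndepFun (fun j ω => X j ω * w j) P :=
    h.comp (fun j x => x * w j) fun j => by fun_prop
  rw [hind.charFun_map_fun_sum_eq_prod hm]
  ext t
  simp only [Finset.prod_apply, (gaussianReal_mul_const (hX _) (w _)).map_eq, charFun_gaussianReal,
    ← Complex.exp_sum]
  congr 1
  have hw' : ∑ j, (w j : ℂ) ^ 2 = 1 := by exact_mod_cast hw
  simp [← Finset.sum_div, ← Finset.sum_mul, hw']

/-- On `[-1, 1]` the density is at least `1/3 * 1/2 ≥ 1/16`, and the interval has length `2t`. -/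
theorem le_gaussianReal_real_abs_le {t : ℝ} (h0 : 0 ≤ t) (h1 : t ≤ 1) :
    t / 8 ≤ (gaussianReal 0 1).real {x | |x| ≤ t} := by
  have hset : {x : ℝ | |x| ≤ t} = Set.Icc (-t) t := by ext x; simp [abs_le]
  rw [hset, Measure.real, gaussianReal_apply_eq_integral 0 one_ne_zero,
    ENNReal.toReal_ofReal (integral_nonneg fun x => gaussianPDFReal_nonneg _ _ _)]
  have hπ : √(2 * Real.pi) ≤ 3 := by
    rw [Real.sqrt_le_left (by norm_num)]
    linarith [Real.pi_lt_four]
  have hle : ∀ x ∈ Set.Icc (-t) t, 1 / 16 ≤ gaussianPDFReal 0 1 x := by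
    intro x hx
    have hx1 : x ^ 2 ≤ 1 := by
      rw [sq_le_one_iff_abs_le_one, abs_le]
      constructor <;> linarith [hx.1, hx.2]
    have he : 1 / 2 ≤ Real.exp (-x ^ 2 / 2) := by
      linarith [Real.add_one_le_exp (-x ^ 2 / 2)]
    have hs : (1 : ℝ) / 3 ≤ (√(2 * Real.pi))⁻¹ := by
      rw [one_div]
      exact inv_anti₀ (by positivity) hπ
    simp only [gaussianPDFReal, NNReal.coe_one, mul_one, sub_zero]
    calc (1 : ℝ) / 16 ≤ 1 / 3 * (1 / 2) := by norm_num
      _ ≤ _ := by gcongr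
  calc t / 8 = ∫ _ in Set.Icc (-t) t, (1 / 16 : ℝ) := by
        simp [h0]; ring
    _ ≤ _ := by
        refine setIntegral_mono_on (by simp) (integrable_gaussianPDFReal 0 1).integrableOn
          measurableSet_Icc hle

theorem gaussianPDFReal_mul_exp_sq_div_four (x : ℝ) :
    gaussianPDFReal 0 1 x * Real.exp (1 / 4 * x ^ 2) =
      (√(2 * Real.pi))⁻¹ * Real.exp (-(1 / 4) * x ^ 2) := by
  simp only [gaussianPDFReal, NNReal.coe_one, mul_one, sub_zero, mul_assoc, ← Real.exp_add]
  ring_nf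

theorem integrable_exp_sq_div_four_gaussianReal :
    Integrable (fun x : ℝ => Real.exp (1 / 4 * x ^ 2)) (gaussianReal 0 1) := by
  rw [gaussianReal_of_var_ne_zero _ one_ne_zero,
    integrable_withDensity_iff_integrable_smul' (measurable_gaussianPDF _ _)
      (Filter.Eventually.of_forall fun _ => gaussianPDF_lt_top)]
  simp only [toReal_gaussianPDF, smul_eq_mul, gaussianPDFReal_mul_exp_sq_div_four]
  exact (integrable_exp_neg_mul_sq (by norm_num)).const_mul _

theorem integral_exp_sq_div_four_gaussianReal :
    ∫ x : ℝ, Real.exp (1 / 4 * x ^ 2) ∂(gaussianReal 0 1) = √2 := by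
  rw [integral_gaussianReal_eq_integral_smul one_ne_zero]
  simp only [smul_eq_mul, gaussianPDFReal_mul_exp_sq_div_four]
  rw [integral_const_mul, integral_gaussian, ← Real.sqrt_inv, ← Real.sqrt_mul (by positivity)]
  congr 1
  field_simp
  norm_num

/-- Upper tail of the chi-square distribution with `N` degrees of freedom. -/
theorem measureReal_four_mul_le_sum_sq [IsProbabilityMeasure P] {N : ℕ} {Y : Fin N → Ω → ℝ}
    (hY : ∀ i, HasLaw (Y i) (gaussianReal 0 1) P) (h : iIndepFun Y P) :
    P.real {ω | 4 * (N : ℝ) ≤ ∑ i, Y i ω ^ 2} ≤ Real.exp (-(1 / 2) * N) := by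
  have hind : iIndepFun (fun i ω => Y i ω ^ 2) P :=
    h.comp (fun _ x => x ^ 2) fun _ => by fun_prop
  have hm (i : Fin N) : AEMeasurable (fun ω => Y i ω ^ 2) P := (hY i).aemeasurable.pow_const 2
  have hmgf (i : Fin N) : mgf (fun ω => Y i ω ^ 2) P (1 / 4) = √2 := by
    rw [← integral_exp_sq_div_four_gaussianReal]
    exact (hY i).integral_comp (f := fun x => Real.exp (1 / 4 * x ^ 2))
      integrable_exp_sq_div_four_gaussianReal.aestronglyMeasurable
  have hsum : mgf (∑ i, fun ω => Y i ω ^ 2) P (1 / 4) = √2 ^ N := by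
    rw [hind.mgf_sum₀ hm, Finset.prod_congr rfl fun i _ => hmgf i]
    simp
  have hint : Integrable (fun ω => Real.exp (1 / 4 * (∑ i, fun ω => Y i ω ^ 2) ω)) P := by
    -- A non-integrable exponential would give `mgf` its default value `0`, but it equals `√2 ^ N`.
    by_contra hc
    have := mgf_undef hc
    rw [hsum] at this
    exact absurd this (by positivity)
  have key := measure_ge_le_exp_mul_mgf (4 * (N : ℝ)) (by norm_num) hint
  rw [hsum] at key
  simp only [Finset.sum_apply] at key
  refine key.trans ?_
  have h2 : √2 ≤ Real.exp (1 / 2) := by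
    rw [Real.sqrt_le_left (Real.exp_pos _).le, ← Real.exp_nat_mul]
    norm_num
    linarith [Real.add_one_le_exp (1 : ℝ)]
  calc Real.exp (-(1 / 4) * (4 * (N : ℝ))) * √2 ^ N
      ≤ Real.exp (-(1 / 4) * (4 * (N : ℝ))) * Real.exp (1 / 2) ^ N := by gcongr
    _ = Real.exp (-(1 / 2) * N) := by
        rw [← Real.exp_nat_mul, ← Real.exp_add]
        ring_nf

/-- If `k / N` is at most half of the probability of `[-t, t]`, it is unlikely that fewer than `k`
of `N` independent standard normal variables lie in `[-t, t]`. -/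
theorem measureReal_card_abs_le_lt [IsProbabilityMeasure P] {N k : ℕ} {Y : Fin N → Ω → ℝ}
    (hY : ∀ i, HasLaw (Y i) (gaussianReal 0 1) P) (h : iIndepFun Y P) {t : ℝ}
    (ht : 2 * (k : ℝ) ≤ N * (gaussianReal 0 1).real {x | |x| ≤ t}) :
    P.real {ω | (Finset.univ.filter fun i => |Y i ω| ≤ t).card < k} ≤
      Real.exp (-(2 * k ^ 2 / N)) := by
  set s : Set ℝ := {x | |x| ≤ t}
  have hs : MeasurableSet s := measurableSet_le (by fun_prop) (by fun_prop)
  -- The sign turns "too few hits" into an upper tail event.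
  let f : ℝ → ℝ := s.indicator fun _ => -1
  have hf : Measurable f := measurable_const.indicator hs
  have hmem (x : ℝ) : f x ∈ Set.Icc (-1 : ℝ) 0 := by
    by_cases hx : x ∈ s <;> simp [f, hx]
  have hmean (i : Fin N) : ∫ ω, f (Y i ω) ∂P = -(gaussianReal 0 1).real s := by
    refine ((hY i).integral_comp hf.aestronglyMeasurable).trans ?_
    simp [f, integral_indicator_const _ hs]
  have hsub (i : Fin N) :
      HasSubgaussianMGF (fun ω => f (Y i ω) + (gaussianReal 0 1).real s) (1 / 4) P := by
    have := hasSubgaussianMGF_of_mem_Icc (μ := P) (X := fun ω => f (Y i ω))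
      (hf.comp_aemeasurable (hY i).aemeasurable) (Filter.Eventually.of_forall fun ω => hmem _)
    rw [hmean] at this
    convert! this using 1
    · simp
    · ext; norm_num
  have hind : iIndepFun (fun i ω => f (Y i ω) + (gaussianReal 0 1).real s) P :=
    h.comp (fun _ x => f x + (gaussianReal 0 1).real s) fun _ => by fun_prop
  have key := HasSubgaussianMGF.measure_sum_ge_le_of_iIndepFun hind (s := Finset.univ)
    (fun i _ => hsub i) (Nat.cast_nonneg k)
  refine (measureReal_mono ?_).trans (key.trans_eq ?_)
  · intro ω hω
    have hcard : ∑ i, f (Y i ω) = -((Finset.univ.filter fun i => |Y i ω| ≤ t).card : ℝ) := by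
      simp [f, s, Set.indicator_apply, Finset.sum_ite]
    have hlt : ((Finset.univ.filter fun i => |Y i ω| ≤ t).card : ℝ) < k := by exact_mod_cast hω
    simp only [Set.mem_ofPred_eq, Finset.sum_add_distrib, hcard, Finset.sum_const,
      Finset.card_univ, Fintype.card_fin, nsmul_eq_mul]
    -- By `ht`, the centred sum exceeds `2k - k = k`.
    linarith
  · congr 1
    simp only [Finset.sum_const, Finset.card_univ, Fintype.card_fin, nsmul_eq_mul]
    push_cast
    rcases N.eq_zero_or_pos with rfl | hN
    · simp
    · field_simp
      norm_num

end Gaussian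

theorem exists_exp_neg_mul_le_rpow {a : ℝ} (ha : 0 < a) (α : ℝ) :
    ∃ C : ℝ, 0 < C ∧ ∀ N : ℕ, 0 < N → Real.exp (-a * N) ≤ C * (N : ℝ) ^ (-α) := by
  obtain ⟨C, hC⟩ := ((tendsto_rpow_mul_exp_neg_mul_atTop_nhds_zero α a ha).comp
    tendsto_natCast_atTop_atTop).bddAbove_range
  refine ⟨max C 1, by positivity, fun N hN => ?_⟩
  have h : (N : ℝ) ^ α * Real.exp (-a * N) ≤ C := hC ⟨N, rfl⟩
  have hpos : (0 : ℝ) < (N : ℝ) ^ α := by positivity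
  rw [Real.rpow_neg (Nat.cast_nonneg N), ← div_eq_mul_inv, le_div_iff₀ hpos, mul_comm]
  exact h.trans (le_max_left _ _)

/-- Otherwise the at least `k` indices with `b j ≤ t` would form a proper subset of the `k`
smallest. -/
theorem le_of_mem_smallestIndices_of_le_card {N : ℕ} {b : Fin N → ℝ} {k : ℕ} (hk : k ≤ N) {t : ℝ}
    (h : k ≤ (Finset.univ.filter fun i => b i ≤ t).card) {i : Fin N}
    (hi : i ∈ smallestIndices b k) : b i ≤ t := by
  by_contra! hlt
  have hss : (Finset.univ.filter fun i => b i ≤ t) ⊂ smallestIndices b k := by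
    refine (Finset.ssubset_iff_of_subset fun j hj => ?_).2 ⟨i, hi, by simpa using hlt⟩
    by_contra hj'
    exact absurd ((le_of_mem_smallestIndices b hi hj').trans (Finset.mem_filter.1 hj).2)
      (not_le.2 hlt)
  have := Finset.card_lt_card hss
  rw [card_smallestIndices b hk] at this
  omega

theorem inv_sqrt_mul_norm_subvector_le {N : ℕ} {b : Fin N → ℝ} {I : Finset (Fin N)} {k : ℕ}
    (hk : 0 < k) {M : ℝ} (hM : 0 ≤ M) (h : ∑ i ∈ I, b i ^ 2 ≤ k * M ^ 2) :
    (√(k : ℝ))⁻¹ * ‖subvector b I‖ ≤ M := by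
  have hk' : 0 < √(k : ℝ) := by positivity
  rw [inv_mul_le_iff₀ hk']
  refine le_of_sq_le_sq ?_ (by positivity)
  rwa [norm_sq_subvector, mul_pow, Real.sq_sqrt (Nat.cast_nonneg k)]

section Magnitudes

variable {Ω : Type*} [MeasurableSpace Ω] {P : Measure Ω} [IsProbabilityMeasure P] {N n k : ℕ}
  {x₀ : EuclideanSpace ℝ (Fin n)} {A : Ω → Matrix (Fin N) (Fin n) ℝ}

theorem IsStdGaussianMatrix.hasLaw_mulVec (hA : IsStdGaussianMatrix P A) (hx : ‖x₀‖ = 1)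
    (i : Fin N) : HasLaw (fun ω => ∑ j, A ω i j * x₀ j) (gaussianReal 0 1) P := by
  refine hasLaw_sum_mul_gaussianReal (hA.hasLaw i)
    (hA.indep.precomp (Prod.mk_right_injective i)) ?_
  rw [← EuclideanSpace.real_norm_sq_eq, hx, one_pow]

theorem IsStdGaussianMatrix.iIndepFun_mulVec (hA : IsStdGaussianMatrix P A) :
    iIndepFun (fun i ω => ∑ j, A ω i j * x₀ j) P :=
  (iIndepFun_rows (fun p => (hA.hasLaw p.1 p.2).aemeasurable) hA.indep).comp
    (fun _ r => ∑ j, r j * x₀ j) fun _ => by fun_prop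

/-- The root mean square of the `k` smallest magnitudes exceeds `128 * (k / N)` with
exponentially small probability. -/
theorem IsStdGaussianMatrix.measureReal_lt_inv_sqrt_mul_norm (hA : IsStdGaussianMatrix P A)
    (hx : ‖x₀‖ = 1) (hk : 0 < k) (hkN : k ≤ N) {ρ₀ : ℝ} (hρ₀ : 0 < ρ₀) (hρ : ρ₀ ≤ (k : ℝ) / N) :
    P.real {ω | 128 * ((k : ℝ) / N) < (√(k : ℝ))⁻¹ *
        ‖subvector (magnitudes (A ω) x₀) (smallestIndices (magnitudes (A ω) x₀) k)‖} ≤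
      Real.exp (-min (2 * ρ₀ ^ 2) (1 / 2) * N) := by
  have hN : (0 : ℝ) < N := by exact_mod_cast hk.trans_le hkN
  have hk' : (0 : ℝ) < k := by exact_mod_cast hk
  obtain ⟨ρ, hρdef⟩ : ∃ ρ : ℝ, ρ = (k : ℝ) / N := ⟨_, rfl⟩
  have hkρ : (k : ℝ) = ρ * N := by rw [hρdef]; field_simp
  rw [← hρdef] at hρ ⊢
  have hρpos : 0 < ρ := hρ₀.trans_le hρ
  have hY := hA.hasLaw_mulVec hx
  have hind := hA.iIndepFun_mulVec (x₀ := x₀)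
  rcases le_or_gt ρ (1 / 16) with hsmall | hlarge
  · have hball := le_gaussianReal_real_abs_le (t := 16 * ρ) (by positivity) (by linarith)
    have htail := measureReal_card_abs_le_lt (k := k) hY hind (t := 16 * ρ) (by
      rw [hkρ]; nlinarith)
    refine (measureReal_mono ?_).trans (htail.trans ?_)
    · intro ω hω
      rw [Set.mem_ofPred_eq] at hω
      by_contra hcard
      refine hω.not_ge ?_
      refine inv_sqrt_mul_norm_subvector_le hk (by positivity) ?_
      have hle := fun i hi => le_of_mem_smallestIndices_of_le_card (b := magnitudes (A ω) x₀) hkN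
        (not_lt.1 hcard) (i := i) hi
      calc ∑ i ∈ smallestIndices (magnitudes (A ω) x₀) k, magnitudes (A ω) x₀ i ^ 2
          ≤ (smallestIndices (magnitudes (A ω) x₀) k).card • (16 * ρ) ^ 2 :=
            Finset.sum_le_card_nsmul _ _ _ fun i hi =>
              pow_le_pow_left₀ (abs_nonneg _) (hle i hi) 2
        _ ≤ k * (128 * ρ) ^ 2 := by
            rw [card_smallestIndices _ hkN, nsmul_eq_mul]
            gcongr
            norm_num
    · rw [Real.exp_le_exp, hkρ, neg_mul, neg_le_neg_iff]
      calc min (2 * ρ₀ ^ 2) (1 / 2) * N ≤ 2 * ρ ^ 2 * N := by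
            gcongr
            exact (min_le_left _ _).trans (by gcongr)
        _ = 2 * (ρ * N) ^ 2 / N := by field_simp
  · refine (measureReal_mono ?_).trans ((measureReal_four_mul_le_sum_sq hY hind).trans ?_)
    · intro ω hω
      rw [Set.mem_ofPred_eq] at hω
      by_contra hsum
      refine hω.not_ge ?_
      refine inv_sqrt_mul_norm_subvector_le hk (by positivity) ?_
      -- The constant 128 is fixed here: `128² / 16³ = 4`.
      have hcube : (1 / 16 : ℝ) ^ 3 ≤ ρ ^ 3 := by gcongr
      calc ∑ i ∈ smallestIndices (magnitudes (A ω) x₀) k, magnitudes (A ω) x₀ i ^ 2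
          ≤ ∑ i, magnitudes (A ω) x₀ i ^ 2 :=
            Finset.sum_le_univ_sum_of_nonneg fun i => sq_nonneg _
        _ = ∑ i, (∑ j, A ω i j * x₀ j) ^ 2 := by simp [magnitudes]
        _ ≤ 4 * N := (not_le.1 hsum).le
        _ ≤ k * (128 * ρ) ^ 2 := by
            rw [hkρ]
            nlinarith
    · rw [Real.exp_le_exp, neg_mul, neg_mul, neg_le_neg_iff]
      gcongr
      exact min_le_right _ _

end Magnitudes

theorem mainTheorem3 :
    ∀ c : ℝ, 0 < c → ∃ c₆ : ℝ, 0 < c₆ ∧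
      ∀ ρ₀ : ℝ, 0 < ρ₀ → ∀ α : ℝ, 1 ≤ α → ∃ cα : ℝ, 0 < cα ∧
        ∀ (Ω : Type*) [MeasurableSpace Ω] (P : Measure Ω) [IsProbabilityMeasure P]
          (N n N_I : ℕ) (x₀ : EuclideanSpace ℝ (Fin n))
          (A : Ω → Matrix (Fin N) (Fin n) ℝ),
          ‖x₀‖ = 1 → IsStdGaussianMatrix P A →
          1 ≤ N_I → N_I ≤ N → ρ₀ ≤ (N_I : ℝ) / N → (N_I : ℝ) / N < c →
          1 - cα * (N : ℝ) ^ (-α) ≤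
            P.real {ω |
              (√(N_I : ℝ))⁻¹ *
                  ‖subvector (magnitudes (A ω) x₀)
                    (smallestIndices (magnitudes (A ω) x₀) N_I)‖
                ≤ c₆ * √(Real.pi / 6) * ((N_I : ℝ) / N)} := by
  intro c _
  have hπ : 0 < √(Real.pi / 6) := by positivity
  refine ⟨128 / √(Real.pi / 6), by positivity, fun ρ₀ hρ₀ α _ => ?_⟩
  obtain ⟨C, hC, hexp⟩ :=
    exists_exp_neg_mul_le_rpow (a := min (2 * ρ₀ ^ 2) (1 / 2)) (by positivity) α
  refine ⟨C, hC, fun Ω _ P _ N n k x₀ A hx hA hk hkN hρ _ => ?_⟩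
  rw [div_mul_cancel₀ _ hπ.ne']
  have htail := (hA.measureReal_lt_inv_sqrt_mul_norm hx hk hkN hρ₀ hρ).trans
    (hexp N (hk.trans hkN))
  simp_rw [← not_le] at htail
  -- Subadditivity gives `1 ≤ P E + P Eᶜ` without measurability of the event `E`.
  have hunion := measureReal_union_le (μ := P)
    {ω | (√(k : ℝ))⁻¹ *
        ‖subvector (magnitudes (A ω) x₀) (smallestIndices (magnitudes (A ω) x₀) k)‖
          ≤ 128 * ((k : ℝ) / N)}
    {ω | (√(k : ℝ))⁻¹ *
        ‖subvector (magnitudes (A ω) x₀) (smallestIndices (magnitudes (A ω) x₀) k)‖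
          ≤ 128 * ((k : ℝ) / N)}ᶜ
  rw [Set.union_compl_self, probReal_univ] at hunion
  have hcompl := hunion.trans (add_le_add_right htail _)
  linarith
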